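/- Let $d\ge 1$, let $\nu>0$ be real, and let $\mathcal R$ be a $d\times d$ correlation matrix (symmetric positive semidefinite with unit diagonal) with Cholesky factor $\mathcal L$, that is, $\mathcal R=\mathcal L\mathcal L^{\top}$ with $\mathcal L$ lower triangular with nonnegative diagonal entries. For $m>0$ let $t(m,0,1)$ be the standard Student distribution with $m$ degrees of freedom, let $T_m$ be its distribution function and $T_m^{-1}:(0,1)\to\mathbb R$ the inverse of $T_m$. Let $\boldsymbol t_d(\nu,\boldsymbol 0,\mathcal R)$ be the law of $\sqrt{\nu/W}\,N$ with $W\sim\chi^2_\nu$ and $N\sim\mathcal N_d(\boldsymbol 0,\mathcal R)$ independent, and let the Student copula be $C^{St}(u_1,\dots,u_d,\nu,\mathcal R)=\mathbb P\big(T_\nu(S_1)\le u_1,\dots,T_\nu(S_d)\le u_d\big)$ for $S\sim\boldsymbol t_d(\nu,\boldsymbol 0,\mathcal R)$. Let $X_1,\dots,X_d$ be real random variables with arbitrary (continuous, discrete or mixed) marginal distribution functions $F_1,\dots,F_d$. Write $F_k^{\leftarrow}(u)=\inf\{x: F_k(x)\ge u\}$ and $\tau_{F_k}(x,\lambda)=\mathbb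 P(X_k<x)+\lambda\,\mathbb P(X_k=x)$. Let $j\in\{1,\dots,d\}$, let $(w_1,\dots,w_{d-1})$ be any enumeration of $\{1,\dots,d\}\setminus\{j\}$, and put $\boldsymbol X_{\sim j}=(X_{w_1},\dots,X_{w_{d-1}})$. Let $U_j\sim\mathcal U(0,1)$ and $Z_{w_i}\sim t(\nu+i,0,1)$, $i=1,\dots,d-1$, be such that $X_j,U_j,Z_{w_1},\dots,Z_{w_{d-1}}$ are independent, and write $\boldsymbol Z=(Z_{w_1},\dots,Z_{w_{d-1}})$. Suppose that $(X_j,\boldsymbol X_{\sim j})$ has $C^{St}(\cdot,\nu,\mathcal R)$ as copula, that is, $\mathbb P(X_j\le x_j,X_{w_1}\le x_{w_1},\dots,X_{w_{d-1}}\le x_{w_{d-1}})=C^{St}\big(F_j(x_j),F_{w_1}(x_{w_1}),\dots,F_{w_{d-1}}(x_{w_{d-1}}),\nu,\mathcal R\big)$ for all real $x_1,\dots,x_d$. Put $\theta=T_\nu^{-1}(\tau_{F_j}(X_j,U_j))$, $$\begin{bmatrix}Y_j\\ Y_{w_1}\\ \vdots\\ Y_{w_{d-1}}\end{bmatrix}=\mathcal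 L\begin{bmatrix}\theta\\ E_1\\ \vdots\\ E_{d-1}\end{bmatrix},\qquad E_i=\sqrt{\frac{(\nu+\theta^2)\prod_{k=1}^{i-1}(\nu+k+Z_{w_k}^2)}{\prod_{k=1}^{i}(\nu+k)}}\;Z_{w_i}\quad(1\le i\le d-1),$$ and $$r_j(X_j,\boldsymbol Z,U_j)=\big(F_{w_1}^{\leftarrow}[T_\nu(Y_{w_1})],\dots,F_{w_{d-1}}^{\leftarrow}[T_\nu(Y_{w_{d-1}})]\big).$$ Then $r_j$ is a dependency function of $(X_j,\boldsymbol X_{\sim j})$: it is measurable, its $i$-th component depends only on $X_j,U_j,Z_{w_1},\dots,Z_{w_i}$, and $$\boldsymbol X_{\sim j}\overset{d}{=}r_j(X_j,\boldsymbol Z,U_j),\qquad (X_j,\boldsymbol X_{\sim j})\overset{d}{=}\big(X_j,r_j(X_j,\boldsymbol Z,U_j)\big).$$ -/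

import Mathlib

open MeasureTheory ProbabilityTheory

noncomputable section

/-- Density of the standard Student distribution `t(ν, 0, 1)` with `ν` degrees of freedom. -/
def studentPDF (ν x : ℝ) : ℝ :=
  Real.Gamma ((ν + 1) / 2) / (Real.sqrt (ν * Real.pi) * Real.Gamma (ν / 2))
    * (1 + x ^ 2 / ν) ^ (-((ν + 1) / 2))

/-- The standard Student distribution `t(ν, 0, 1)` on the line. -/
def studentMeasure (ν : ℝ) : Measure ℝ :=
  volume.withDensity fun x => ENNReal.ofReal (studentPDF ν x)

/-- `T_ν`, the distribution function of `t(ν, 0, 1)`. -/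
def studentCDF (ν x : ℝ) : ℝ :=
  (studentMeasure ν).real (Set.Iic x)

/-- `T_ν⁻¹`, the inverse function of `T_ν : ℝ → (0, 1)`. -/
def studentCDFInv (ν : ℝ) : ℝ → ℝ :=
  Function.invFun (studentCDF ν)

/-- The centred multivariate Student distribution `t_d(ν, 0, R)`: the law of `√(ν / W) • N`, where
`W` is chi-squared with `ν` degrees of freedom (the Gamma law of shape `ν / 2` and rate `1 / 2`),
`N` is Gaussian with mean `0` and covariance matrix `R`, and `W`, `N` are independent.
The matrix `R` may be singular. -/
def multivariateStudent {d : ℕ} (ν : ℝ) (R : Matrix (Fin d) (Fin d) ℝ) : Measure (Fin d → ℝ) :=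
  ((gammaMeasure (ν / 2) (1 / 2)).prod (multivariateGaussian 0 R)).map
    fun p k => Real.sqrt (ν / p.1) * p.2 k

/-- The Student copula `C^{St}(u_1, …, u_d; ν, R)`: the joint distribution function of
`(T_ν(Y_1), …, T_ν(Y_d))` for `Y ∼ t_d(ν, 0, R)`. For `u` in `(0, 1)^d` this is
`P (Y_1 ≤ T_ν⁻¹(u_1), …, Y_d ≤ T_ν⁻¹(u_d))`; it also gives the right values on the boundary
of the cube. -/
def studentCopula {d : ℕ} (ν : ℝ) (R : Matrix (Fin d) (Fin d) ℝ) (u : Fin d → ℝ) : ℝ :=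
  (multivariateStudent ν R).real {y | ∀ k, studentCDF ν (y k) ≤ u k}

/-- The random vector `X` has `C` as copula: `F(x) = C(F_1(x_1), …, F_d(x_d))` for all `x`, with `F`
the joint and `F_k` the marginal distribution functions. -/
def HasCopula {Ω : Type*} [MeasurableSpace Ω] (P : Measure Ω) {d : ℕ} (X : Fin d → Ω → ℝ)
    (C : (Fin d → ℝ) → ℝ) : Prop :=
  ∀ x : Fin d → ℝ, P.real {ω | ∀ k, X k ω ≤ x k} = C fun k => cdf (P.map (X k)) (x k)

/-- The generalized inverse `F^←(u) = inf {x | u ≤ F x}`. -/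
def generalizedInverse (F : ℝ → ℝ) (u : ℝ) : ℝ :=
  sInf {x | u ≤ F x}

/-- The distributional transform `τ_F(x, u) = P(X < x) + u P(X = x)` of a variable `X ∼ μ`. -/
def distributionalTransform (μ : Measure ℝ) (x u : ℝ) : ℝ :=
  μ.real (Set.Iio x) + u * μ.real {x}

/-- `R` is a correlation matrix. -/
structure IsCorrelationMatrix {d : ℕ} (R : Matrix (Fin d) (Fin d) ℝ) : Prop where
  posSemidef : R.PosSemidef
  diag_eq_one : ∀ k, R k k = 1

/-- `L` is a Cholesky factor of `R`. The diagonal is only required to be nonnegative, so that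
singular `R` are covered; for nonsingular `R` it is then positive, and `L` is unique. -/
structure IsCholeskyFactor {d : ℕ} (L R : Matrix (Fin d) (Fin d) ℝ) : Prop where
  lower_triangular : ∀ i k, i < k → L i k = 0
  diag_nonneg : ∀ k, 0 ≤ L k k
  eq_mul_transpose : R = L * L.transpose

/-- The vector to which `L` is applied, in the coordinates `(j, w_1, …, w_n)`: its first entry
is `t`, and its entry for `w_i` is
`√((ν + t²) ∏_{k=1}^{i-1} (ν + k + z_{w_k}²) / ∏_{k=1}^{i} (ν + k)) z_{w_i}`.
Here `z_{w_1}, …, z_{w_n}` are `z 0, …, z (n-1)`. -/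
def studentInnovation {n : ℕ} (ν t : ℝ) (z : Fin n → ℝ) : Fin (n + 1) → ℝ :=
  Fin.cons t fun i : Fin n =>
    Real.sqrt (((ν + t ^ 2) * ∏ k ∈ Finset.Iio i, (ν + ((k : ℝ) + 1) + z k ^ 2))
      / ∏ k ∈ Finset.Iic i, (ν + ((k : ℝ) + 1))) * z i

/-- The vector `Y = (Y_j, Y_{w_1}, …, Y_{w_n})` as a function of `v = (x_j, u_j)` and `z`, where
`μ₀` is the law of `X_j`. -/
def studentY {n : ℕ} (ν : ℝ) (L : Matrix (Fin (n + 1)) (Fin (n + 1)) ℝ) (μ₀ : Measure ℝ)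
    (v : ℝ × ℝ) (z : Fin n → ℝ) : Fin (n + 1) → ℝ :=
  L.mulVec (studentInnovation ν (studentCDFInv ν (distributionalTransform μ₀ v.1 v.2)) z)

/-- The map with components `F_{w_i}^←(T_ν(Y_{w_i}))`, where `μ i` is the law of `X_{w_i}`. -/
def studentDependencyFunction {n : ℕ} (ν : ℝ) (L : Matrix (Fin (n + 1)) (Fin (n + 1)) ℝ)
    (μ₀ : Measure ℝ) (μ : Fin n → Measure ℝ) (v : ℝ × ℝ) (z : Fin n → ℝ) : Fin n → ℝ :=
  fun i => generalizedInverse (cdf (μ i)) (studentCDF ν (studentY ν L μ₀ v z i.succ))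

/-- `r`, evaluated at `((X₀, U), Z)`, is a dependency function of `(X₀, X')`: it is measurable, its
`i`-th component uses only the first `i` innovations, the innovations `Z`, the randomization `U`
and `X₀` are all independent, and `r((X₀, U), Z)` reproduces the law of `X'`, alone and jointly
with `X₀`. -/
structure IsDependencyFunction {Ω : Type*} [MeasurableSpace Ω] (P : Measure Ω) {n : ℕ}
    (X₀ : Ω → ℝ) (X' : Fin n → Ω → ℝ) (U : Ω → ℝ) (Z : Fin n → Ω → ℝ)
    (r : ℝ × ℝ → (Fin n → ℝ) → Fin n → ℝ) : Prop where
  measurable : Measurable fun p : (ℝ × ℝ) × (Fin n → ℝ) => r p.1 p.2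
  nested : ∀ (i : Fin n) (v : ℝ × ℝ) (z z' : Fin n → ℝ),
    (∀ k ≤ i, z k = z' k) → r v z i = r v z' i
  indep : iIndepFun (Fin.cons X₀ (Fin.cons U Z) : Fin (n + 2) → Ω → ℝ) P
  identDistrib : IdentDistrib (fun ω i => X' i ω)
    (fun ω => r (X₀ ω, U ω) fun i => Z i ω) P P
  identDistrib_joint : IdentDistrib (fun ω => (X₀ ω, fun i => X' i ω))
    (fun ω => (X₀ ω, r (X₀ ω, U ω) fun i => Z i ω)) P P

end

/-! The heart is that `(θ, E_1, …, E_n)` has the law of `√(ν/W) N` with `N` standard normal. In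
dimension one, `(√(ν/W) N_1, ν/W)` has the law of `(T, (ν + T²)/W')`, with `T` Student and `W'` an
independent chi-squared variable with `ν + 1` degrees of freedom
(`lintegral_gamma_gaussian_eq_lintegral_student_gamma`). Hence, given the first coordinate `t`, the
others form a standard Student vector with `ν + 1` degrees of freedom, scaled by `√((ν + t²)/(ν +
1))`. The innovations obey the same recursion, so induction on the dimension gives
`map_studentInnovation`. Applying `L` yields `t_d(ν, 0, L Lᵀ)`.

This applies to `θ` because the distributional transform of `X_j` is uniform for every marginal,
atoms included (`map_distributionalTransform`), so `θ` is Student.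

It remains to compare joint distribution functions. The first row of `L` is `(1, 0, …, 0)`, so
`T_ν(Y_j) = τ(X_j, U_j)` almost surely, and `{X_j ≤ x}` agrees almost surely with `{τ ≤ F_j(x)}`.
For the other coordinates, `F^←(u) ≤ x` iff `u ≤ F(x)`. So `(X_j, r_j)` has joint distribution
function `C^{St}(F_j, F_{w_1}, …)`, which the copula hypothesis attributes to `X`. -/

/-! ### The one-dimensional Student law and its conditional chi-squared scale. -/

theorem lintegral_eq_mul_lintegral_comp_mul_left {c : ℝ} (hc : 0 < c) {f : ℝ → ENNReal}
    (hf : Measurable f) : ∫⁻ x, f x = ENNReal.ofReal c * ∫⁻ x, f (c * x) := by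
  rw [← lintegral_map hf (measurable_const_mul c), Real.map_volume_mul_left hc.ne',
    lintegral_smul_measure, smul_eq_mul, ← mul_assoc, ← ENNReal.ofReal_mul hc.le,
    abs_of_pos (inv_pos.2 hc), mul_inv_cancel₀ hc.ne', ENNReal.ofReal_one, one_mul]

theorem measurable_studentPDF (ν : ℝ) : Measurable (studentPDF ν) := by
  unfold studentPDF
  fun_prop

theorem studentPDF_pos {ν : ℝ} (hν : 0 < ν) (x : ℝ) : 0 < studentPDF ν x := by
  unfold studentPDF
  have := Real.Gamma_pos_of_pos (show 0 < (ν + 1) / 2 by positivity)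
  have := Real.Gamma_pos_of_pos (show 0 < ν / 2 by positivity)
  positivity

/-- The joint density of a chi-squared variable `W` and of `√(ν / W) N`, with `N` standard normal,
in terms of the Student density and the conditional density of `W`. -/
theorem gammaPDFReal_mul_gaussianPDFReal {ν w : ℝ} (hν : 0 < ν) (hw : 0 < w) (t : ℝ) :
    gammaPDFReal (ν / 2) (1 / 2) w * (Real.sqrt (w / ν) *
        gaussianPDFReal 0 1 (Real.sqrt (w / ν) * t)) =
      studentPDF ν t * ((1 + t ^ 2 / ν) *
        gammaPDFReal ((ν + 1) / 2) (1 / 2) ((1 + t ^ 2 / ν) * w)) := by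
  have hc : 0 < 1 + t ^ 2 / ν := by positivity
  set c := 1 + t ^ 2 / ν with hcdef
  have hG1 := Real.Gamma_pos_of_pos (show 0 < (ν + 1) / 2 by positivity)
  have hG2 := Real.Gamma_pos_of_pos (show 0 < ν / 2 by positivity)
  have hpi := Real.pi_pos
  rw [gammaPDFReal, if_pos hw.le, gammaPDFReal, if_pos (by positivity), gaussianPDFReal,
    studentPDF, ← hcdef]
  have e1 : Real.exp (-(1 / 2 * (c * w))) = Real.exp (-(1 / 2 * w)) *
      Real.exp (-(Real.sqrt (w / ν) * t - 0) ^ 2 / (2 * ((1 : NNReal) : ℝ))) := by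
    rw [← Real.exp_add, sub_zero, mul_pow, Real.sq_sqrt (by positivity), hcdef]
    congr 1
    push_cast
    ring
  -- The factor `√w` matches the Jacobian `√(w/ν)` on the left, and the division by `c` cancels the
  -- Jacobian `c` on the right.
  have e2 : (c * w) ^ ((ν + 1) / 2 - 1) =
      c ^ ((ν + 1) / 2) / c * (w ^ (ν / 2 - 1) * Real.sqrt w) := by
    rw [Real.mul_rpow hc.le hw.le, Real.rpow_sub hc, Real.rpow_one, Real.sqrt_eq_rpow,
      ← Real.rpow_add hw]
    congr 2
    ring
  have e3 : c ^ (-((ν + 1) / 2)) = (c ^ ((ν + 1) / 2))⁻¹ := Real.rpow_neg hc.le _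
  have e4 : (1 / 2 : ℝ) ^ ((ν + 1) / 2) = (1 / 2) ^ (ν / 2) * (Real.sqrt 2)⁻¹ := by
    rw [← Real.sqrt_inv, Real.sqrt_eq_rpow, ← one_div, ← Real.rpow_add (by norm_num)]
    congr 1
    ring
  have hcp : 0 < c ^ ((ν + 1) / 2) := Real.rpow_pos_of_pos hc _
  rw [e1, e2, e3, e4, Real.sqrt_div hw.le, NNReal.coe_one, mul_one,
    Real.sqrt_mul (by norm_num), Real.sqrt_mul hν.le]
  have h2 : 0 < Real.sqrt 2 := by positivity
  have hp : 0 < Real.sqrt Real.pi := by positivity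
  have hn : 0 < Real.sqrt ν := by positivity
  generalize Real.exp (-(1 / 2 * w)) = A
  generalize Real.exp _ = B
  field_simp

theorem lintegral_gaussianReal_zero_one (f : ℝ → ENNReal) :
    ∫⁻ x, f x ∂gaussianReal 0 1 = ∫⁻ x, gaussianPDF 0 1 x * f x := by
  rw [gaussianReal_of_var_ne_zero _ one_ne_zero,
    lintegral_withDensity_eq_lintegral_mul_non_measurable _ (measurable_gaussianPDF _ _)]
  · rfl
  · exact Filter.Eventually.of_forall fun x => gaussianPDF_lt_top

theorem measurable_gammaPDF (a r : ℝ) : Measurable (gammaPDF a r) :=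
  (measurable_gammaPDFReal a r).ennreal_ofReal

theorem lintegral_gammaMeasure (a r : ℝ) (f : ℝ → ENNReal) :
    ∫⁻ x, f x ∂gammaMeasure a r = ∫⁻ x, gammaPDF a r x * f x := by
  rw [gammaMeasure,
    lintegral_withDensity_eq_lintegral_mul_non_measurable _ (measurable_gammaPDF _ _)]
  · rfl
  · exact Filter.Eventually.of_forall fun x => ENNReal.ofReal_lt_top

theorem lintegral_studentMeasure (ν : ℝ) (f : ℝ → ENNReal) :
    ∫⁻ x, f x ∂studentMeasure ν = ∫⁻ x, ENNReal.ofReal (studentPDF ν x) * f x := by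
  rw [studentMeasure, lintegral_withDensity_eq_lintegral_mul_non_measurable _
    (measurable_studentPDF ν).ennreal_ofReal]
  · rfl
  · exact Filter.Eventually.of_forall fun x => ENNReal.ofReal_lt_top

instance sigmaFinite_gammaMeasure (a r : ℝ) : SigmaFinite (gammaMeasure a r) := by
  unfold gammaMeasure
  exact SigmaFinite.withDensity_ofReal _

/-- If `W` is chi-squared with `ν` degrees of freedom and `N` is standard normal, then
`(√(ν / W) N, ν / W)` has the law of `(T, (ν + T²) / W')`, where `T` is Student with `ν` degrees of
freedom and `W'` is an independent chi-squared variable with `ν + 1` degrees of freedom. -/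
theorem lintegral_gamma_gaussian_eq_lintegral_student_gamma {ν : ℝ} (hν : 0 < ν)
    {g : ℝ → ℝ → ENNReal} (hg : Measurable (Function.uncurry g)) :
    ∫⁻ w, ∫⁻ x, g (Real.sqrt (ν / w) * x) (ν / w) ∂gaussianReal 0 1 ∂gammaMeasure (ν / 2) (1 / 2) =
      ∫⁻ t, ∫⁻ w, g t ((ν + t ^ 2) / w) ∂gammaMeasure ((ν + 1) / 2) (1 / 2)
        ∂studentMeasure ν := by
  have hm : Measurable (gaussianPDF 0 1) := measurable_gaussianPDF 0 1
  have hm' := measurable_gammaPDF ((ν + 1) / 2) (1 / 2)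
  have hs := measurable_studentPDF ν
  have hgt : ∀ t, Measurable (g t) := fun t => hg.comp measurable_prodMk_left
  calc _ = ∫⁻ w, ∫⁻ t, gammaPDF (ν / 2) (1 / 2) w * (ENNReal.ofReal (Real.sqrt (w / ν)) *
          (gaussianPDF 0 1 (Real.sqrt (w / ν) * t) * g t (ν / w))) := by
        rw [lintegral_gammaMeasure]
        refine lintegral_congr_ae ?_
        -- At `w = 0` the scale `ν / w` has its default value and the substitution degenerates; this
        -- point is null.
        filter_upwards [compl_mem_ae_iff.2 (measure_singleton (0 : ℝ))] with w hw0
        rcases lt_or_gt_of_ne hw0 with hw | hw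
        · simp [gammaPDF_of_neg hw]
        have hr : 0 < Real.sqrt (w / ν) := by positivity
        have h1 : ∀ t, Real.sqrt (ν / w) * (Real.sqrt (w / ν) * t) = t := fun t => by
          rw [← mul_assoc, ← Real.sqrt_mul (by positivity), div_mul_div_cancel₀ hw.ne',
            div_self hν.ne', Real.sqrt_one, one_mul]
        have hmg : Measurable fun x => g (Real.sqrt (ν / w) * x) (ν / w) :=
          hg.comp (by fun_prop : Measurable fun x : ℝ => (Real.sqrt (ν / w) * x, ν / w))
        have htop : gammaPDF (ν / 2) (1 / 2) w ≠ ⊤ := ENNReal.ofReal_ne_top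
        rw [lintegral_gaussianReal_zero_one, lintegral_const_mul' _ _ htop,
          lintegral_const_mul' _ _ ENNReal.ofReal_ne_top]
        congr 1
        -- Substitute `x = √(w/ν) t`, so that `t` becomes the Student coordinate.
        refine (lintegral_eq_mul_lintegral_comp_mul_left hr (hm.mul hmg)).trans ?_
        simp only [Pi.mul_apply, h1]
    _ = ∫⁻ w, ∫⁻ t, ENNReal.ofReal (studentPDF ν t) * (ENNReal.ofReal (1 + t ^ 2 / ν) *
          (gammaPDF ((ν + 1) / 2) (1 / 2) ((1 + t ^ 2 / ν) * w) * g t (ν / w))) := by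
        refine lintegral_congr_ae ?_
        filter_upwards [compl_mem_ae_iff.2 (measure_singleton (0 : ℝ))] with w hw0
        refine lintegral_congr fun t => ?_
        rcases lt_or_gt_of_ne hw0 with hw | hw
        · rw [gammaPDF_of_neg hw, gammaPDF_of_neg (mul_neg_of_pos_of_neg (by positivity) hw)]
          simp
        · have := congrArg ENNReal.ofReal (gammaPDFReal_mul_gaussianPDFReal hν hw t)
          rw [ENNReal.ofReal_mul (gammaPDFReal_nonneg (by positivity) (by norm_num) _),
            ENNReal.ofReal_mul (by positivity), ENNReal.ofReal_mul (studentPDF_pos hν t).le,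
            ENNReal.ofReal_mul (by positivity)] at this
          simp only [gammaPDF, gaussianPDF, ← mul_assoc] at this ⊢
          rw [this]
    _ = ∫⁻ t, ∫⁻ w, ENNReal.ofReal (studentPDF ν t) * (ENNReal.ofReal (1 + t ^ 2 / ν) *
          (gammaPDF ((ν + 1) / 2) (1 / 2) ((1 + t ^ 2 / ν) * w) * g t (ν / w))) := by
        refine lintegral_lintegral_swap (Measurable.aemeasurable ?_)
        have h3 : Measurable fun p : ℝ × ℝ => g p.2 (ν / p.1) :=
          hg.comp (by fun_prop : Measurable fun p : ℝ × ℝ => (p.2, ν / p.1))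
        have h4 : Measurable fun p : ℝ × ℝ =>
            gammaPDF ((ν + 1) / 2) (1 / 2) ((1 + p.2 ^ 2 / ν) * p.1) :=
          hm'.comp (by fun_prop)
        exact (hs.comp measurable_snd).ennreal_ofReal.mul
          (Measurable.mul (by fun_prop) (h4.mul h3))
    _ = _ := by
        rw [lintegral_studentMeasure]
        refine lintegral_congr fun t => ?_
        have hc : 0 < 1 + t ^ 2 / ν := by positivity
        have h1 : ∀ w, (ν + t ^ 2) / ((1 + t ^ 2 / ν) * w) = ν / w := fun w => by
          rw [← div_div]
          congr 1
          field_simp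
        have hmg : Measurable fun w => g t ((ν + t ^ 2) / w) := (hgt t).comp (by fun_prop)
        rw [lintegral_gammaMeasure, lintegral_const_mul' _ _ ENNReal.ofReal_ne_top,
          lintegral_const_mul' _ _ ENNReal.ofReal_ne_top]
        congr 1
        -- Rescaling `w` by `1 + t²/ν` turns `ν / w` into `(ν + t²) / w`.
        refine Eq.trans ?_ (lintegral_eq_mul_lintegral_comp_mul_left hc (hm'.mul hmg)).symm
        simp only [Pi.mul_apply, h1]

/-- Testing the preceding identity on the constant `1` gives the normalization without a Beta
integral. -/
theorem isProbabilityMeasure_studentMeasure {ν : ℝ} (hν : 0 < ν) :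
    IsProbabilityMeasure (studentMeasure ν) where
  measure_univ := by
    have h₁ := (isProbabilityMeasure_gammaMeasure (show 0 < ν / 2 by positivity)
      (show (0 : ℝ) < 1 / 2 by norm_num)).measure_univ
    have h₂ := (isProbabilityMeasure_gammaMeasure (show 0 < (ν + 1) / 2 by positivity)
      (show (0 : ℝ) < 1 / 2 by norm_num)).measure_univ
    simpa only [lintegral_const, measure_univ, h₁, h₂, one_mul] using (lintegral_gamma_gaussian_eq_lintegral_student_gamma hν
      (g := fun _ _ => 1) measurable_const).symm

instance sigmaFinite_studentMeasure (ν : ℝ) : SigmaFinite (studentMeasure ν) := by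
  unfold studentMeasure
  exact SigmaFinite.withDensity_ofReal _

/-! ### Peeling coordinates: the law of the innovation vector. -/

/-- Integration against a product measure on `Fin (n + 1) → α`, first coordinate first. -/
theorem lintegral_pi_fin_succ {n : ℕ} {α : Type*} [MeasurableSpace α]
    (μ : Fin (n + 1) → Measure α) [∀ i, SigmaFinite (μ i)] {f : (Fin (n + 1) → α) → ENNReal}
    (hf : Measurable f) :
    ∫⁻ x, f x ∂Measure.pi μ =
      ∫⁻ x, ∫⁻ y, f (Fin.cons x y) ∂Measure.pi (fun i => μ i.succ) ∂μ 0 := by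
  have h := (measurePreserving_piFinSuccAbove μ 0).symm
  have hm := h.measurable
  refine (h.lintegral_comp hf).symm.trans ((lintegral_prod _ (hf.comp hm).aemeasurable).trans ?_)
  simp [MeasurableEquiv.piFinSuccAbove, Fin.insertNthEquiv, Fin.zero_succAbove]

theorem Fin.prod_Iio_succ_eq_mul {M : Type*} [CommMonoid M] {n : ℕ} (f : Fin (n + 1) → M)
    (i : Fin n) : ∏ k ∈ Finset.Iio i.succ, f k = f 0 * ∏ k ∈ Finset.Iio i, f k.succ := by
  have h : Finset.Iio i.succ = insert 0 ((Finset.Iio i).map (Fin.succEmb n)) := by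
    ext k
    cases k using Fin.cases <;> simp
  rw [h, Finset.prod_insert (by simp), Finset.prod_map]
  rfl

theorem Fin.prod_Iic_succ_eq_mul {M : Type*} [CommMonoid M] {n : ℕ} (f : Fin (n + 1) → M)
    (i : Fin n) : ∏ k ∈ Finset.Iic i.succ, f k = f 0 * ∏ k ∈ Finset.Iic i, f k.succ := by
  have h : Finset.Iic i.succ = insert 0 ((Finset.Iic i).map (Fin.succEmb n)) := by
    ext k
    cases k using Fin.cases <;> simp
  rw [h, Finset.prod_insert (by simp), Finset.prod_map]
  rfl

/-- `ν + t²` and `ν + 1` occur under every root and factor out; what is left has the same form, with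
`ν + 1` for `ν` and `z` for `t`. -/
theorem studentInnovation_cons {n : ℕ} {ν : ℝ} (hν : 0 < ν) (t z : ℝ) (zs : Fin n → ℝ) :
    studentInnovation ν t (Fin.cons z zs : Fin (n + 1) → ℝ) =
      Fin.cons t (Real.sqrt ((ν + t ^ 2) / (ν + 1)) • studentInnovation (ν + 1) z zs) := by
  unfold studentInnovation
  congr 1
  funext i
  cases i using Fin.cases with
  | zero =>
    have h0 : Finset.Iio (0 : Fin (n + 1)) = ∅ := by ext k; simp
    have h1 : Finset.Iic (0 : Fin (n + 1)) = {0} := by ext k; simp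
    simp [h0, h1]
  | succ i =>
    rw [Fin.prod_Iio_succ_eq_mul, Fin.prod_Iic_succ_eq_mul]
    simp only [Fin.cons_zero, Fin.cons_succ, Pi.smul_apply, smul_eq_mul, Fin.val_zero,
      Nat.cast_zero, zero_add, Fin.val_succ, Nat.cast_add, Nat.cast_one]
    have e : ∀ k : Fin n, ν + ((k : ℝ) + 1 + 1) = ν + 1 + ((k : ℝ) + 1) := fun k => by ring
    simp only [e]
    rw [← mul_assoc (√_) (√_) (zs i), ← Real.sqrt_mul (by positivity), div_mul_div_comm]

/-- The law of `√(ν / W) N` with `N` standard normal in `ℝ^d`. -/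
noncomputable def standardStudent (d : ℕ) (ν : ℝ) : Measure (Fin d → ℝ) :=
  ((gammaMeasure (ν / 2) (1 / 2)).prod (Measure.pi fun _ => gaussianReal 0 1)).map
    fun p k => Real.sqrt (ν / p.1) * p.2 k

theorem lintegral_standardStudent {d : ℕ} {ν : ℝ} {f : (Fin d → ℝ) → ENNReal}
    (hf : Measurable f) :
    ∫⁻ y, f y ∂standardStudent d ν =
      ∫⁻ w, ∫⁻ x, f (Real.sqrt (ν / w) • x) ∂Measure.pi (fun _ => gaussianReal 0 1)
        ∂gammaMeasure (ν / 2) (1 / 2) := by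
  have hm : Measurable fun p : ℝ × (Fin d → ℝ) => fun k => Real.sqrt (ν / p.1) * p.2 k := by
    fun_prop
  rw [standardStudent, lintegral_map hf hm]
  exact lintegral_prod _ (hf.comp hm).aemeasurable

theorem isProbabilityMeasure_standardStudent (d : ℕ) {ν : ℝ} (hν : 0 < ν) :
    IsProbabilityMeasure (standardStudent d ν) := by
  have := isProbabilityMeasure_gammaMeasure (show 0 < ν / 2 by positivity)
    (show (0 : ℝ) < 1 / 2 by norm_num)
  exact Measure.isProbabilityMeasure_map (Measurable.aemeasurable (by fun_prop))

/-- The remaining normals see the first one only through the common scale, whose conditional law is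
that of `(ν + t²)/W' = ((ν + t²)/(ν + 1)) · ((ν + 1)/W')`. -/
theorem lintegral_standardStudent_succ {d : ℕ} {ν : ℝ} (hν : 0 < ν)
    {f : (Fin (d + 1) → ℝ) → ENNReal} (hf : Measurable f) :
    ∫⁻ y, f y ∂standardStudent (d + 1) ν =
      ∫⁻ t, ∫⁻ y, f (Fin.cons t (Real.sqrt ((ν + t ^ 2) / (ν + 1)) • y))
        ∂standardStudent d (ν + 1) ∂studentMeasure ν := by
  -- With the other normals integrated out, only the first coordinate and the squared scale `v`
  -- remain.
  let g : ℝ → ℝ → ENNReal := fun t v =>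
    ∫⁻ x, f (Fin.cons t (Real.sqrt v • x)) ∂Measure.pi (fun _ : Fin d => gaussianReal 0 1)
  have hg : Measurable (Function.uncurry g) := by
    refine Measurable.lintegral_prod_right' (f := fun p : (ℝ × ℝ) × (Fin d → ℝ) =>
      f (Fin.cons p.1.1 (Real.sqrt p.1.2 • p.2))) (hf.comp ?_)
    fun_prop
  rw [lintegral_standardStudent hf]
  trans ∫⁻ w, ∫⁻ x, g (Real.sqrt (ν / w) * x) (ν / w) ∂gaussianReal 0 1
    ∂gammaMeasure (ν / 2) (1 / 2)
  · refine lintegral_congr fun w => ?_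
    refine (lintegral_pi_fin_succ _ (hf.comp (measurable_const_smul (√(ν / w))))).trans ?_
    refine lintegral_congr fun x => lintegral_congr fun y => congrArg f ?_
    funext k
    cases k using Fin.cases <;> simp
  rw [lintegral_gamma_gaussian_eq_lintegral_student_gamma hν hg]
  refine lintegral_congr fun t => ?_
  have hm : Measurable fun y : Fin d → ℝ =>
      (Fin.cons t (√((ν + t ^ 2) / (ν + 1)) • y) : Fin (d + 1) → ℝ) := by fun_prop
  refine Eq.trans ?_ (lintegral_standardStudent (hf.comp hm)).symm
  refine lintegral_congr fun w => lintegral_congr fun x => ?_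
  rw [Function.comp, smul_smul, ← Real.sqrt_mul (by positivity), div_mul_div_cancel₀ (by positivity)]

theorem measurable_studentInnovation (n : ℕ) (ν : ℝ) :
    Measurable fun p : ℝ × (Fin n → ℝ) => studentInnovation ν p.1 p.2 := by
  unfold studentInnovation
  refine measurable_pi_iff.2 fun k => ?_
  cases k using Fin.cases with
  | zero => exact measurable_fst
  | succ i =>
    simp only [Fin.cons_succ]
    fun_prop

theorem lintegral_studentInnovation (n : ℕ) {ν : ℝ} (hν : 0 < ν)
    {f : (Fin (n + 1) → ℝ) → ENNReal} (hf : Measurable f) :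
    ∫⁻ t, ∫⁻ z, f (studentInnovation ν t z)
        ∂Measure.pi (fun i : Fin n => studentMeasure (ν + ((i : ℝ) + 1))) ∂studentMeasure ν =
      ∫⁻ y, f y ∂standardStudent (n + 1) ν := by
  -- `ν` must vary, since peeling a coordinate raises it by one.
  induction n generalizing ν with
  | zero =>
    rw [lintegral_standardStudent_succ hν hf]
    refine lintegral_congr fun t => ?_
    have := isProbabilityMeasure_standardStudent 0 (show 0 < ν + 1 by positivity)
    have h : ∀ y : Fin 0 → ℝ, f (Fin.cons t (Real.sqrt ((ν + t ^ 2) / (ν + 1)) • y)) =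
        f (studentInnovation ν t finZeroElim) := fun y => by
      congr 1
      funext k
      cases k using Fin.cases with
      | zero => rfl
      | succ i => exact i.elim0
    have h' : ∀ z : Fin 0 → ℝ, f (studentInnovation ν t z) =
        f (studentInnovation ν t finZeroElim) := fun z => by
      rw [Subsingleton.elim z finZeroElim]
    rw [lintegral_congr h, lintegral_congr h']
    simp
  | succ n ih =>
    rw [lintegral_standardStudent_succ hν hf]
    refine lintegral_congr fun t => ?_
    have hm : Measurable fun z : Fin (n + 1) → ℝ => studentInnovation ν t z :=
      (measurable_studentInnovation (n + 1) ν).comp (measurable_const.prodMk measurable_id)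
    have hm' : Measurable fun y : Fin (n + 1) → ℝ =>
        (Fin.cons t (√((ν + t ^ 2) / (ν + 1)) • y) : Fin (n + 1 + 1) → ℝ) := by fun_prop
    have hrec := ih (show 0 < ν + 1 by positivity) (hf.comp hm')
    refine (lintegral_pi_fin_succ _ (hf.comp hm)).trans (Eq.trans ?_ hrec)
    simp only [Function.comp, studentInnovation_cons hν, Fin.val_zero, Nat.cast_zero, zero_add,
      Fin.val_succ, Nat.cast_add, Nat.cast_one, add_assoc, add_comm (1 : ℝ)]

theorem map_studentInnovation (n : ℕ) {ν : ℝ} (hν : 0 < ν) :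
    ((studentMeasure ν).prod
        (Measure.pi fun i : Fin n => studentMeasure (ν + ((i : ℝ) + 1)))).map
      (fun p => studentInnovation ν p.1 p.2) = standardStudent (n + 1) ν := by
  refine Measure.ext_of_lintegral _ fun f hf => ?_
  have hm := measurable_studentInnovation n ν
  rw [lintegral_map hf hm, ← lintegral_studentInnovation n hν hf]
  exact lintegral_prod _ (hf.comp hm).aemeasurable

/-! ### Linear images: from the standard vector to `t_d(ν, 0, L Lᵀ)`. -/

/-- `L N` is centred Gaussian with covariance matrix `L Lᵀ`. -/
theorem map_mulVec_pi_gaussianReal {ι : Type*} [Fintype ι] [DecidableEq ι] (L : Matrix ι ι ℝ) :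
    (Measure.pi fun _ : ι => gaussianReal 0 1).map (fun x => WithLp.toLp 2 (L.mulVec x)) =
      multivariateGaussian 0 (L * L.transpose) := by
  have hS : (L * L.transpose).PosSemidef := by
    have := Matrix.posSemidef_self_mul_conjTranspose L
    rwa [Matrix.conjTranspose_eq_transpose_of_trivial] at this
  refine Measure.ext_of_charFun ?_
  ext t
  have hm : Measurable fun x : ι → ℝ => WithLp.toLp 2 (L.mulVec x) := by
    unfold Matrix.mulVec dotProduct
    fun_prop
  rw [charFun_multivariateGaussian hS, charFun_apply, integral_map hm.aemeasurable (by fun_prop)]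
  -- Since `⟨L x, t⟩ = ⟨x, Lᵀ t⟩`, the characteristic function of `L N` at `t` is the standard one
  -- at `Lᵀ t`.
  have h := charFun_stdGaussian (WithLp.toLp 2 (L.transpose.mulVec t.ofLp))
  rw [← map_pi_eq_stdGaussian, charFun_apply, integral_map (by fun_prop) (by fun_prop)] at h
  have e : ∀ x : ι → ℝ, inner ℝ (WithLp.toLp 2 (L.mulVec x)) t =
      inner ℝ (WithLp.toLp 2 x) (WithLp.toLp 2 (L.transpose.mulVec t.ofLp)) := fun x => by
    rw [EuclideanSpace.inner_eq_star_dotProduct, EuclideanSpace.inner_eq_star_dotProduct]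
    simp [Matrix.dotProduct_mulVec, Matrix.mulVec_transpose]
  simp only [e]
  rw [h]
  congr 1
  have e2 : ‖WithLp.toLp 2 (L.transpose.mulVec t.ofLp)‖ ^ 2 =
      dotProduct t.ofLp ((L * L.transpose).mulVec t.ofLp) := by
    rw [EuclideanSpace.real_norm_sq_eq, ← Matrix.mulVec_mulVec, Matrix.dotProduct_mulVec,
      ← Matrix.mulVec_transpose]
    simp [dotProduct, sq]
  rw [← Complex.ofReal_pow, e2]
  simp [neg_div]

theorem measurable_mulVec {ι κ : Type*} [Fintype ι] [Fintype κ] (L : Matrix ι κ ℝ) :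
    Measurable L.mulVec := by
  unfold Matrix.mulVec dotProduct
  fun_prop

/-- `L` commutes with the random scalar `√(ν/W)`, so it acts on the Gaussian factor alone. -/
theorem map_mulVec_standardStudent {d : ℕ} {ν : ℝ} (hν : 0 < ν) (L : Matrix (Fin d) (Fin d) ℝ) :
    (standardStudent d ν).map L.mulVec = multivariateStudent ν (L * L.transpose) := by
  have := isProbabilityMeasure_gammaMeasure (show 0 < ν / 2 by positivity)
    (show (0 : ℝ) < 1 / 2 by norm_num)
  have hL := measurable_mulVec L
  have hL' : Measurable fun x : Fin d → ℝ => WithLp.toLp 2 (L.mulVec x) := by fun_prop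
  have hp := Measure.map_prod_map (gammaMeasure (ν / 2) (1 / 2))
    (Measure.pi fun _ : Fin d => gaussianReal 0 1) measurable_id hL'
  rw [Measure.map_id] at hp
  rw [multivariateStudent, ← map_mulVec_pi_gaussianReal, hp, standardStudent,
    Measure.map_map hL (by fun_prop), Measure.map_map (by fun_prop) (measurable_id.prodMap hL')]
  congr 1
  funext p
  exact Matrix.mulVec_smul L (√(ν / p.1)) p.2

/-! ### The Student distribution function and its inverse. -/

theorem studentMeasure_singleton (ν x : ℝ) : studentMeasure ν {x} = 0 :=
  withDensity_absolutelyContinuous _ _ (measure_singleton x)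

theorem studentMeasure_pos_of_volume_pos {ν : ℝ} (hν : 0 < ν) {s : Set ℝ}
    (h : volume s ≠ 0) : studentMeasure ν s ≠ 0 := by
  intro h0
  refine h (withDensity_absolutelyContinuous' (f := fun x => ENNReal.ofReal (studentPDF ν x))
    (measurable_studentPDF ν).ennreal_ofReal.aemeasurable ?_ h0)
  exact Filter.Eventually.of_forall fun x => (ENNReal.ofReal_pos.2 (studentPDF_pos hν x)).ne'

theorem studentCDF_eq_cdf {ν : ℝ} (hν : 0 < ν) : studentCDF ν = cdf (studentMeasure ν) := by
  have := isProbabilityMeasure_studentMeasure hν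
  funext x
  rw [cdf_eq_real, studentCDF]

theorem strictMono_studentCDF {ν : ℝ} (hν : 0 < ν) : StrictMono (studentCDF ν) := by
  have := isProbabilityMeasure_studentMeasure hν
  intro a b hab
  unfold studentCDF
  rw [← Set.Iic_union_Ioc_eq_Iic hab.le,
    measureReal_union (Set.Iic_disjoint_Ioc le_rfl) measurableSet_Ioc]
  have h := studentMeasure_pos_of_volume_pos hν (s := Set.Ioc a b) (by simpa using hab)
  have : 0 < (studentMeasure ν).real (Set.Ioc a b) :=
    ENNReal.toReal_pos h (measure_ne_top _ _)
  linarith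

theorem continuous_studentCDF {ν : ℝ} (hν : 0 < ν) : Continuous (studentCDF ν) := by
  have := isProbabilityMeasure_studentMeasure hν
  rw [studentCDF_eq_cdf hν, continuous_iff_continuousAt]
  intro x
  have h := (cdf (studentMeasure ν)).measure_singleton x
  rw [measure_cdf, studentMeasure_singleton] at h
  refine ((cdf (studentMeasure ν)).mono.continuousAt_iff_leftLim_eq_rightLim).2 ?_
  rw [StieltjesFunction.rightLim_eq]
  refine le_antisymm ((cdf (studentMeasure ν)).mono.leftLim_le le_rfl) ?_
  exact sub_nonpos.1 (ENNReal.ofReal_eq_zero.1 h.symm)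

theorem studentCDF_mem_Ioo {ν : ℝ} (hν : 0 < ν) (x : ℝ) : studentCDF ν x ∈ Set.Ioo (0 : ℝ) 1 := by
  have hs := strictMono_studentCDF hν
  constructor
  · refine lt_of_le_of_lt ?_ (hs (sub_one_lt x))
    exact measureReal_nonneg
  · refine lt_of_lt_of_le (hs (lt_add_one x)) ?_
    rw [studentCDF_eq_cdf hν]
    exact cdf_le_one _ _

theorem studentCDF_studentCDFInv {ν : ℝ} (hν : 0 < ν) {u : ℝ} (hu : u ∈ Set.Ioo (0 : ℝ) 1) :
    studentCDF ν (studentCDFInv ν u) = u := by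
  refine Function.invFun_eq ?_
  refine mem_range_of_exists_le_of_exists_ge (continuous_studentCDF hν) ?_ ?_
  · rw [studentCDF_eq_cdf hν]
    exact ((tendsto_cdf_atBot _).eventually_le_const hu.1).exists
  · rw [studentCDF_eq_cdf hν]
    exact ((tendsto_cdf_atTop _).eventually_const_le hu.2).exists

theorem studentCDFInv_le_iff {ν : ℝ} (hν : 0 < ν) {u : ℝ} (hu : u ∈ Set.Ioo (0 : ℝ) 1) (x : ℝ) :
    studentCDFInv ν u ≤ x ↔ u ≤ studentCDF ν x := by
  rw [← (strictMono_studentCDF hν).le_iff_le, studentCDF_studentCDFInv hν hu]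

theorem measurable_studentCDFInv {ν : ℝ} (hν : 0 < ν) : Measurable (studentCDFInv ν) := by
  -- Off `(0, 1)` there is no preimage, and `Function.invFun` takes one fixed default value.
  have hout : ∀ u, u ∉ Set.Ioo (0 : ℝ) 1 → studentCDFInv ν u = studentCDFInv ν 0 := by
    intro u hu
    have hno : ∀ v, v ∉ Set.Ioo (0 : ℝ) 1 → ¬ ∃ x, studentCDF ν x = v := by
      rintro v hv ⟨x, rfl⟩
      exact hv (studentCDF_mem_Ioo hν x)
    rw [studentCDFInv, Function.invFun_neg (hno u hu), Function.invFun_neg (hno 0 (by simp))]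
  refine measurable_of_Iic fun x => ?_
  have h : studentCDFInv ν ⁻¹' Set.Iic x = (Set.Ioo 0 1 ∩ Set.Iic (studentCDF ν x)) ∪
      ((Set.Ioo (0 : ℝ) 1)ᶜ ∩ {_u | studentCDFInv ν 0 ≤ x}) := by
    ext u
    by_cases hu : u ∈ Set.Ioo (0 : ℝ) 1
    · simp [hu, studentCDFInv_le_iff hν hu x]
    · simp [hu, hout u hu]
  rw [h]
  exact (measurableSet_Ioo.inter measurableSet_Iic).union
    (measurableSet_Ioo.compl.inter (MeasurableSet.const _))

/-! ### Generalized inverses and the distributional transform. -/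

/-- Right continuity makes the infimum attained. For `u` in `(0, 1)` the set is nonempty and bounded
below, so `sInf` is a genuine infimum. -/
theorem generalizedInverse_cdf_le_iff (μ : Measure ℝ) {u : ℝ} (hu : u ∈ Set.Ioo (0 : ℝ) 1)
    (x : ℝ) : generalizedInverse (cdf μ) u ≤ x ↔ u ≤ cdf μ x := by
  have hne : {x | u ≤ cdf μ x}.Nonempty :=
    ((tendsto_cdf_atTop μ).eventually_const_le hu.2).exists
  have hbdd : BddBelow {x | u ≤ cdf μ x} := by
    obtain ⟨b, hb⟩ := ((tendsto_cdf_atBot μ).eventually_lt_const hu.1).exists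
    refine ⟨b, fun y hy => le_of_lt ?_⟩
    by_contra! h
    exact absurd ((monotone_cdf μ h).trans_lt hb) (not_lt.2 hy)
  refine ⟨fun h => ?_, fun h => csInf_le hbdd h⟩
  have hcl : ∀ y, x < y → u ≤ cdf μ y := fun y hy => by
    obtain ⟨z, hz, hzy⟩ := (csInf_lt_iff hbdd hne).1 (lt_of_le_of_lt h hy)
    exact le_trans hz (monotone_cdf μ hzy.le)
  refine ge_of_tendsto (((cdf μ).right_continuous x).mono Set.Ioi_subset_Ici_self) ?_
  filter_upwards [self_mem_nhdsWithin] with y hy using hcl y hy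

theorem measurable_generalizedInverse_cdf_comp {α : Type*} [MeasurableSpace α] (μ : Measure ℝ)
    {f : α → ℝ} (hf : Measurable f) (hf' : ∀ a, f a ∈ Set.Ioo (0 : ℝ) 1) :
    Measurable fun a => generalizedInverse (cdf μ) (f a) := by
  refine measurable_of_Iic fun x => ?_
  have h : (fun a => generalizedInverse (cdf μ) (f a)) ⁻¹' Set.Iic x = f ⁻¹' Set.Iic (cdf μ x) := by
    ext a
    exact generalizedInverse_cdf_le_iff μ (hf' a) x
  rw [h]
  exact hf measurableSet_Iic

theorem measurable_distributionalTransform (μ : Measure ℝ) [IsProbabilityMeasure μ] :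
    Measurable fun p : ℝ × ℝ => distributionalTransform μ p.1 p.2 := by
  have h1 : Measurable fun x => μ.real (Set.Iio x) := by
    refine Monotone.measurable fun a b hab => ?_
    exact measureReal_mono (Set.Iio_subset_Iio hab)
  have h2 : Measurable fun x => μ.real {x} := by
    have h : (fun x => μ.real {x}) = fun x => μ.real (Set.Iic x) - μ.real (Set.Iio x) := by
      funext x
      rw [← Set.Iio_union_right, measureReal_union (by simp) (measurableSet_singleton x)]
      ring
    rw [h]
    refine Measurable.sub (Monotone.measurable fun a b hab => ?_) h1
    exact measureReal_mono (Set.Iic_subset_Iic.2 hab)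
  unfold distributionalTransform
  exact (h1.comp measurable_fst).add (measurable_snd.mul (h2.comp measurable_fst))

theorem distributionalTransform_le_cdf (μ : Measure ℝ) [IsProbabilityMeasure μ] {x u : ℝ}
    (hu : u ≤ 1) : distributionalTransform μ x u ≤ cdf μ x := by
  rw [cdf_eq_real, ← Set.Iio_union_right, measureReal_union (by simp) (measurableSet_singleton x),
    distributionalTransform]
  have : 0 ≤ μ.real {x} := measureReal_nonneg
  nlinarith

instance isProbabilityMeasure_restrict_Ioo_zero_one :
    IsProbabilityMeasure ((volume : Measure ℝ).restrict (Set.Ioo 0 1)) :=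
  ⟨by simp⟩

theorem measureReal_Iio_generalizedInverse_le (μ : Measure ℝ) [IsProbabilityMeasure μ] {u : ℝ}
    (hu : u ∈ Set.Ioo (0 : ℝ) 1) : μ.real (Set.Iio (generalizedInverse (cdf μ) u)) ≤ u := by
  set q := generalizedInverse (cdf μ) u with hq
  have h := (cdf μ).measure_Iio (tendsto_cdf_atBot μ) q
  rw [measure_cdf, sub_zero] at h
  rw [measureReal_def, h]
  refine ENNReal.toReal_le_of_le_ofReal hu.1.le (ENNReal.ofReal_le_ofReal ?_)
  refine le_of_tendsto ((monotone_cdf μ).tendsto_leftLim q) ?_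
  filter_upwards [self_mem_nhdsWithin] with x hx
  by_contra! hlt
  exact absurd ((generalizedInverse_cdf_le_iff μ hu x).2 hlt.le) (not_le.2 hx)

/-- Here `m` is the mass of an atom and `s` the share of it that the randomization must place below
a level. Allowing `m = 0` covers points that are not atoms. -/
theorem le_mul_measureReal_mul_le {m s : ℝ} (hm : 0 ≤ m) (hs : s ≤ m) :
    s ≤ m * ((volume : Measure ℝ).restrict (Set.Ioo 0 1)).real {v | v * m ≤ s} := by
  rcases hm.eq_or_lt with rfl | hm
  · simpa using hs
  have h : Set.Ioo 0 (s / m) ⊆ {v | v * m ≤ s} := fun v hv => ((lt_div_iff₀ hm).1 hv.2).le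
  have h' : Set.Ioo 0 (s / m) ⊆ Set.Ioo 0 1 := Set.Ioo_subset_Ioo_right ((div_le_one hm).2 hs)
  have := measureReal_mono (μ := (volume : Measure ℝ).restrict (Set.Ioo 0 1)) h
  rw [measureReal_restrict_apply measurableSet_Ioo, Set.inter_eq_left.2 h',
    Real.volume_real_Ioo] at this
  calc s = m * (s / m) := by field_simp
    _ ≤ _ := mul_le_mul_of_nonneg_left (le_trans (by simp) this) hm.le

theorem mul_measureReal_mul_lt_le {m s : ℝ} (hm : 0 ≤ m) (hs : 0 ≤ s) :
    m * ((volume : Measure ℝ).restrict (Set.Ioo 0 1)).real {v | v * m < s} ≤ s := by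
  rcases hm.eq_or_lt with rfl | hm
  · simpa using hs
  have hmeas : MeasurableSet {v : ℝ | v * m < s} := measurableSet_lt (by fun_prop) (by fun_prop)
  have h : {v | v * m < s} ∩ Set.Ioo 0 1 ⊆ Set.Ioo 0 (s / m) :=
    fun v hv => ⟨hv.2.1, (lt_div_iff₀ hm).2 hv.1⟩
  rw [measureReal_restrict_apply hmeas]
  have := measureReal_mono (μ := (volume : Measure ℝ)) h (by simp)
  rw [Real.volume_real_Ioo, sub_zero, max_eq_left (by positivity)] at this
  calc _ ≤ m * (s / m) := mul_le_mul_of_nonneg_left this hm.le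
    _ = s := by field_simp

/-- At `q = F^←(u)`, every `x < q` contributes, giving `F(q-)`, and the randomized atom at `q`
supplies the missing `u - F(q-)`. -/
theorem le_measureReal_distributionalTransform_le (μ : Measure ℝ) [IsProbabilityMeasure μ] {u : ℝ}
    (hu : u ∈ Set.Ioo (0 : ℝ) 1) :
    u ≤ (μ.prod (volume.restrict (Set.Ioo 0 1))).real
      {p | distributionalTransform μ p.1 p.2 ≤ u} := by
  set q := generalizedInverse (cdf μ) u with hq
  have h1 : μ.real (Set.Iio q) ≤ u := measureReal_Iio_generalizedInverse_le μ hu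
  have h2 : u ≤ μ.real (Set.Iio q) + μ.real {q} := by
    have := (generalizedInverse_cdf_le_iff μ hu q).1 le_rfl
    rwa [cdf_eq_real, ← Set.Iio_union_right,
      measureReal_union (by simp) (measurableSet_singleton q)] at this
  have hsub : Set.Iio q ×ˢ Set.Ioo 0 1 ∪ {q} ×ˢ {v | v * μ.real {q} ≤ u - μ.real (Set.Iio q)} ⊆
      {p : ℝ × ℝ | distributionalTransform μ p.1 p.2 ≤ u} := by
    rintro ⟨x, v⟩ (⟨hx, hv⟩ | ⟨hx, hv⟩)
    · refine (distributionalTransform_le_cdf μ hv.2.le).trans ?_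
      by_contra! hlt
      exact absurd ((generalizedInverse_cdf_le_iff μ hu x).2 hlt.le) (not_le.2 hx)
    · simp only [Set.mem_singleton_iff] at hx
      simp only [Set.mem_ofPred_eq, distributionalTransform, hx] at hv ⊢
      linarith
  refine le_trans ?_ (measureReal_mono hsub)
  rw [measureReal_union, measureReal_prod_prod, measureReal_prod_prod]
  · have h3 := le_mul_measureReal_mul_le (m := μ.real {q}) (s := u - μ.real (Set.Iio q))
      measureReal_nonneg (by linarith)
    have h4 : ((volume : Measure ℝ).restrict (Set.Ioo 0 1)).real (Set.Ioo 0 1) = 1 := by simp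
    rw [h4]
    linarith
  · exact Set.disjoint_left.2 fun p hp hp' => (ne_of_lt hp.1) hp'.1
  · exact (measurableSet_singleton q).prod (measurableSet_le (by fun_prop) (by fun_prop))

/-- The strict inequality excludes all `x > q`, where the transform is at least `F(q) ≥ u`; with
`≤`, a flat piece of `F` to the right of `q` could intervene. -/
theorem measureReal_distributionalTransform_lt_le (μ : Measure ℝ) [IsProbabilityMeasure μ] {u : ℝ}
    (hu : u ∈ Set.Ioo (0 : ℝ) 1) :
    (μ.prod (volume.restrict (Set.Ioo 0 1))).real
      {p | distributionalTransform μ p.1 p.2 < u} ≤ u := by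
  set q := generalizedInverse (cdf μ) u with hq
  have h1 : μ.real (Set.Iio q) ≤ u := measureReal_Iio_generalizedInverse_le μ hu
  have h2 : u ≤ μ.real (Set.Iic q) := by
    have := (generalizedInverse_cdf_le_iff μ hu q).1 le_rfl
    rwa [cdf_eq_real] at this
  have hae : ∀ᵐ p ∂μ.prod ((volume : Measure ℝ).restrict (Set.Ioo 0 1)), p.2 ∈ Set.Ioo (0 : ℝ) 1 :=
    Measure.quasiMeasurePreserving_snd.ae (ae_restrict_mem measurableSet_Ioo)
  have hsub : {p : ℝ × ℝ | distributionalTransform μ p.1 p.2 < u}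
      ≤ᵐ[μ.prod ((volume : Measure ℝ).restrict (Set.Ioo 0 1))] (Set.Iio q ×ˢ Set.univ ∪
        {q} ×ˢ {v | v * μ.real {q} < u - μ.real (Set.Iio q)} : Set (ℝ × ℝ)) := by
    filter_upwards [hae] with p hp hlt
    obtain ⟨x, v⟩ := p
    replace hlt : μ.real (Set.Iio x) + v * μ.real {x} < u := hlt
    rcases lt_trichotomy x q with hx | hx | hx
    · exact Or.inl ⟨hx, trivial⟩
    · refine Or.inr ⟨hx, ?_⟩
      rw [hx] at hlt
      simp only [Set.mem_ofPred_eq]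
      linarith
    · have h3 : μ.real (Set.Iic q) ≤ μ.real (Set.Iio x) :=
        measureReal_mono (Set.Iic_subset_Iio.2 hx)
      have h4 : 0 ≤ v * μ.real {x} := mul_nonneg hp.1.le measureReal_nonneg
      linarith
  refine (ENNReal.toReal_mono (measure_ne_top _ _) (measure_mono_ae hsub)).trans ?_
  refine (measureReal_union_le _ _).trans ?_
  rw [measureReal_prod_prod, measureReal_prod_prod]
  have h3 := mul_measureReal_mul_lt_le (m := μ.real {q}) (s := u - μ.real (Set.Iio q))
    measureReal_nonneg (by linarith)
  rw [probReal_univ]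
  linarith

theorem measureReal_distributionalTransform_le (μ : Measure ℝ) [IsProbabilityMeasure μ] {u : ℝ}
    (hu : u ∈ Set.Ioo (0 : ℝ) 1) :
    (μ.prod (volume.restrict (Set.Ioo 0 1))).real
      {p | distributionalTransform μ p.1 p.2 ≤ u} = u := by
  -- For the upper bound, apply the strict estimate at `v` and let `v` decrease to `u`.
  refine le_antisymm (le_of_forall_gt_imp_ge_of_dense fun v hv => ?_)
    (le_measureReal_distributionalTransform_le μ hu)
  rcases lt_or_ge v 1 with hv1 | hv1
  · refine le_trans (measureReal_mono fun p hp => ?_)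
      (measureReal_distributionalTransform_lt_le μ (u := v) ⟨hu.1.trans hv, hv1⟩)
    exact lt_of_le_of_lt hp hv
  · exact measureReal_le_one.trans hv1

/-- The distributional transform of `μ`, applied to a variable with law `μ` and an independent
uniform randomization, is uniform. -/
theorem map_distributionalTransform (μ : Measure ℝ) [IsProbabilityMeasure μ] :
    (μ.prod (volume.restrict (Set.Ioo 0 1))).map
      (fun p => distributionalTransform μ p.1 p.2) = volume.restrict (Set.Ioo 0 1) := by
  have hm := measurable_distributionalTransform μ
  have := Measure.isProbabilityMeasure_map (μ := μ.prod (volume.restrict (Set.Ioo 0 1)))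
    hm.aemeasurable
  have key : ∀ u ∈ Set.Ioo (0 : ℝ) 1, ((μ.prod (volume.restrict (Set.Ioo 0 1))).map
      (fun p => distributionalTransform μ p.1 p.2)).real (Set.Iic u) = u := fun u hu => by
    rw [map_measureReal_apply hm measurableSet_Iic]
    exact measureReal_distributionalTransform_le μ hu
  refine Measure.eq_of_cdf _ _ ?_
  ext u
  rw [cdf_eq_real, cdf_eq_real]
  set ρ := (μ.prod (volume.restrict (Set.Ioo 0 1))).map
      (fun p => distributionalTransform μ p.1 p.2)
  rw [measureReal_restrict_apply measurableSet_Iic]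
  rcases le_or_gt u 0 with h0 | h0
  · have he : Set.Iic u ∩ Set.Ioo 0 1 = ∅ :=
      Set.eq_empty_of_forall_notMem fun v hv => absurd (hv.2.1.trans_le hv.1) (not_lt.2 h0)
    rw [he, measureReal_empty]
    refine le_antisymm (le_of_forall_gt_imp_ge_of_dense fun v hv => ?_) measureReal_nonneg
    rcases lt_or_ge v 1 with hv1 | hv1
    · exact (measureReal_mono (Set.Iic_subset_Iic.2 (h0.trans hv.le))).trans (key v ⟨hv, hv1⟩).le
    · exact measureReal_le_one.trans hv1
  rcases lt_or_ge u 1 with h1 | h1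
  · have he : Set.Iic u ∩ Set.Ioo 0 1 = Set.Ioc 0 u := by
      ext v
      exact ⟨fun hv => ⟨hv.2.1, hv.1⟩, fun hv => ⟨hv.2, hv.1, hv.2.trans_lt h1⟩⟩
    rw [he, key u ⟨h0, h1⟩, Real.volume_real_Ioc_of_le h0.le, sub_zero]
  · have he : Set.Iic u ∩ Set.Ioo 0 1 = Set.Ioo 0 1 :=
      Set.inter_eq_right.2 fun v hv => hv.2.le.trans h1
    rw [he, Real.volume_real_Ioo_of_le zero_le_one, sub_zero]
    refine le_antisymm measureReal_le_one (le_of_forall_lt_imp_le_of_dense fun v hv => ?_)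
    rcases le_or_gt v 0 with hv0 | hv0
    · exact hv0.trans measureReal_nonneg
    · exact (key v ⟨hv0, hv⟩).ge.trans (measureReal_mono (Set.Iic_subset_Iic.2 (hv.le.trans h1)))

theorem map_studentCDFInv {ν : ℝ} (hν : 0 < ν) :
    (volume.restrict (Set.Ioo 0 1)).map (studentCDFInv ν) = studentMeasure ν := by
  have hm := measurable_studentCDFInv hν
  have := isProbabilityMeasure_studentMeasure hν
  have := Measure.isProbabilityMeasure_map (μ := (volume : Measure ℝ).restrict (Set.Ioo 0 1))
    hm.aemeasurable
  refine Measure.eq_of_cdf _ _ ?_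
  ext x
  rw [← congrFun (studentCDF_eq_cdf hν) x, cdf_eq_real, map_measureReal_apply hm measurableSet_Iic,
    measureReal_restrict_apply (hm measurableSet_Iic)]
  have hx := studentCDF_mem_Ioo hν x
  have he : studentCDFInv ν ⁻¹' Set.Iic x ∩ Set.Ioo 0 1 = Set.Ioc 0 (studentCDF ν x) := by
    ext u
    refine ⟨fun hu => ⟨hu.2.1, (studentCDFInv_le_iff hν hu.2 x).1 hu.1⟩, fun hu => ?_⟩
    have hu' : u ∈ Set.Ioo (0 : ℝ) 1 := ⟨hu.1, hu.2.trans_lt hx.2⟩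
    exact ⟨(studentCDFInv_le_iff hν hu' x).2 hu.2, hu'⟩
  rw [he, Real.volume_real_Ioc_of_le hx.1.le, sub_zero]

/-! ### Comparing joint distribution functions. -/

/-- Finite measures on `ℝ^ι` with the same joint distribution function are equal. -/
theorem MeasureTheory.Measure.ext_of_pi_Iic {ι : Type*} [Finite ι] (μ ν : Measure (ι → ℝ))
    [IsFiniteMeasure μ] [IsFiniteMeasure ν] (hun : μ Set.univ = ν Set.univ)
    (h : ∀ x, μ (Set.Iic x) = ν (Set.Iic x)) : μ = ν := by
  refine ext_of_generate_finite (Set.univ.pi '' Set.univ.pi fun _ => Set.range Set.Iic) ?_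
    (IsPiSystem.pi fun _ => isPiSystem_Iic) ?_ hun
  · refine (generateFrom_eq_pi (fun _ => (borel_eq_generateFrom_Iic ℝ).symm) fun _ => ?_).symm
    refine ⟨fun k : ℕ => Set.Iic (k : ℝ), fun k => ⟨_, rfl⟩, ?_⟩
    exact Set.iUnion_eq_univ_iff.2 fun x => exists_nat_ge x
  · rintro _ ⟨s, hs, rfl⟩
    choose x hx using fun i => hs i trivial
    have he : Set.univ.pi s = Set.Iic x := by
      rw [← Set.pi_univ_Iic]
      exact congrArg _ (funext fun i => (hx i).symm)
    rw [he, h]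

/-- The first set lies in the second almost surely, and both have probability `F(x)`. This replaces
inversion of `F`, which atoms and flat pieces prevent. -/
theorem setOf_fst_le_ae_eq_distributionalTransform_le (μ : Measure ℝ) [IsProbabilityMeasure μ]
    (x : ℝ) :
    ({p | p.1 ≤ x} : Set (ℝ × ℝ)) =ᵐ[μ.prod (volume.restrict (Set.Ioo 0 1))]
      {p | distributionalTransform μ p.1 p.2 ≤ cdf μ x} := by
  have hm := measurable_distributionalTransform μ
  have hae : ∀ᵐ p ∂μ.prod ((volume : Measure ℝ).restrict (Set.Ioo 0 1)), p.2 ∈ Set.Ioo (0 : ℝ) 1 :=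
    Measure.quasiMeasurePreserving_snd.ae (ae_restrict_mem measurableSet_Ioo)
  refine ae_eq_of_ae_subset_of_measure_ge ?_ (le_of_eq ?_)
    (measurableSet_le measurable_fst measurable_const).nullMeasurableSet (measure_ne_top _ _)
  · filter_upwards [hae] with p hp hle
    exact (distributionalTransform_le_cdf μ hp.2.le).trans (monotone_cdf μ hle)
  · have h1 : {p : ℝ × ℝ | distributionalTransform μ p.1 p.2 ≤ cdf μ x} =
        (fun p : ℝ × ℝ => distributionalTransform μ p.1 p.2) ⁻¹' Set.Iic (cdf μ x) := rfl
    have h2 : {p : ℝ × ℝ | p.1 ≤ x} = Set.Iic x ×ˢ Set.univ := by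
      ext p
      simp
    -- The sets differ, at the point `1`, only when `F(x) = 1`.
    have h3 : (Set.Iic (cdf μ x) ∩ Set.Ioo 0 1 : Set ℝ) =ᵐ[volume]
        (Set.Ioc 0 (cdf μ x) : Set ℝ) := by
      rw [Filter.eventuallyEq_set]
      filter_upwards [compl_mem_ae_iff.2 (measure_singleton (1 : ℝ))] with v hv
      refine ⟨fun h => ⟨h.2.1, h.1⟩, fun h => ⟨h.2, h.1, ?_⟩⟩
      exact lt_of_le_of_ne (h.2.trans (cdf_le_one μ x)) hv
    rw [h1, ← Measure.map_apply hm measurableSet_Iic, map_distributionalTransform, h2,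
      Measure.prod_prod, measure_univ, mul_one, ← ofReal_cdf μ,
      Measure.restrict_apply measurableSet_Iic, measure_congr h3, Real.volume_Ioc, sub_zero]

/-! ### The vector `Y` and the dependency function. -/

theorem studentInnovation_congr {n : ℕ} (ν t : ℝ) {z z' : Fin n → ℝ} {i : Fin n}
    (h : ∀ k ≤ i, z k = z' k) :
    studentInnovation ν t z i.succ = studentInnovation ν t z' i.succ := by
  simp only [studentInnovation, Fin.cons_succ]
  rw [h i le_rfl, Finset.prod_congr rfl fun k hk => by rw [h k (Finset.mem_Iio.1 hk).le]]

theorem studentY_congr {n : ℕ} (ν : ℝ) {L : Matrix (Fin (n + 1)) (Fin (n + 1)) ℝ}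
    (hL : ∀ i k, i < k → L i k = 0) (μ₀ : Measure ℝ) (v : ℝ × ℝ) {z z' : Fin n → ℝ} {i : Fin n}
    (h : ∀ k ≤ i, z k = z' k) :
    studentY ν L μ₀ v z i.succ = studentY ν L μ₀ v z' i.succ := by
  unfold studentY Matrix.mulVec dotProduct
  refine Finset.sum_congr rfl fun k _ => ?_
  rcases lt_or_ge i.succ k with hk | hk
  · beta_reduce
    rw [hL _ _ hk, zero_mul, zero_mul]
  · cases k using Fin.cases with
    | zero => rfl
    | succ k =>
      rw [studentInnovation_congr ν _ fun m hm => h m (hm.trans (Fin.succ_le_succ_iff.1 hk))]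

/-- Triangularity gives `R 0 0 = (L 0 0)²`; the unit diagonal and the sign condition then force `L 0
0 = 1`, so `Y_j = θ`. -/
theorem studentY_zero {n : ℕ} (ν : ℝ) {L R : Matrix (Fin (n + 1)) (Fin (n + 1)) ℝ}
    (hR : IsCorrelationMatrix R) (hL : IsCholeskyFactor L R) (μ₀ : Measure ℝ) (v : ℝ × ℝ)
    (z : Fin n → ℝ) :
    studentY ν L μ₀ v z 0 = studentCDFInv ν (distributionalTransform μ₀ v.1 v.2) := by
  have h0 : ∀ k : Fin n, L 0 k.succ = 0 := fun k => hL.lower_triangular _ _ (Fin.succ_pos k)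
  have h1 : L 0 0 = 1 := by
    have h := hR.diag_eq_one 0
    rw [hL.eq_mul_transpose, Matrix.mul_apply, Fin.sum_univ_succ] at h
    simp only [Matrix.transpose_apply, h0, mul_zero, Finset.sum_const_zero, add_zero] at h
    nlinarith [hL.diag_nonneg 0]
  simp [studentY, Matrix.mulVec, dotProduct, Fin.sum_univ_succ, h0, h1, studentInnovation]

theorem measurable_studentY {n : ℕ} {ν : ℝ} (hν : 0 < ν)
    (L : Matrix (Fin (n + 1)) (Fin (n + 1)) ℝ) (μ₀ : Measure ℝ) [IsProbabilityMeasure μ₀] :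
    Measurable fun p : (ℝ × ℝ) × (Fin n → ℝ) => studentY ν L μ₀ p.1 p.2 :=
  (measurable_mulVec L).comp <| (measurable_studentInnovation n ν).comp <|
    ((measurable_studentCDFInv hν).comp
      ((measurable_distributionalTransform μ₀).comp measurable_fst)).prodMk measurable_snd

theorem map_studentY {n : ℕ} {ν : ℝ} (hν : 0 < ν) (L : Matrix (Fin (n + 1)) (Fin (n + 1)) ℝ)
    (μ₀ : Measure ℝ) [IsProbabilityMeasure μ₀] :
    ((μ₀.prod (volume.restrict (Set.Ioo 0 1))).prod
        (Measure.pi fun i : Fin n => studentMeasure (ν + ((i : ℝ) + 1)))).map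
      (fun p => studentY ν L μ₀ p.1 p.2) = multivariateStudent ν (L * L.transpose) := by
  have hτ := measurable_distributionalTransform μ₀
  have hT := measurable_studentCDFInv hν
  have hI := measurable_studentInnovation n ν
  have h := Measure.map_prod_map (μ₀.prod (volume.restrict (Set.Ioo 0 1)))
    (Measure.pi fun i : Fin n => studentMeasure (ν + ((i : ℝ) + 1))) (hT.comp hτ) measurable_id
  rw [← Measure.map_map hT hτ, map_distributionalTransform, map_studentCDFInv hν,
    Measure.map_id] at h
  rw [← map_mulVec_standardStudent hν, ← map_studentInnovation n hν, h,
    Measure.map_map hI ((hT.comp hτ).prodMap measurable_id),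
    Measure.map_map (measurable_mulVec L) (hI.comp ((hT.comp hτ).prodMap measurable_id))]
  rfl

theorem measurable_studentDependencyFunction {n : ℕ} {ν : ℝ} (hν : 0 < ν)
    (L : Matrix (Fin (n + 1)) (Fin (n + 1)) ℝ) (μ₀ : Measure ℝ) [IsProbabilityMeasure μ₀]
    (μ : Fin n → Measure ℝ) :
    Measurable fun p : (ℝ × ℝ) × (Fin n → ℝ) =>
      studentDependencyFunction ν L μ₀ μ p.1 p.2 := by
  refine measurable_pi_iff.2 fun i => ?_
  refine measurable_generalizedInverse_cdf_comp (μ i) ?_ fun p => studentCDF_mem_Ioo hν _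
  exact (continuous_studentCDF hν).measurable.comp
    ((measurable_pi_apply i.succ).comp (measurable_studentY hν L μ₀))

/-- The joint law of two variables and a random vector, all independent. -/
theorem map_prod_prod_pi_of_iIndepFun {Ω : Type*} [MeasurableSpace Ω] {P : Measure Ω}
    [IsProbabilityMeasure P] {n : ℕ} {X U : Ω → ℝ} {Z : Fin n → Ω → ℝ}
    (hX : AEMeasurable X P) (hU : AEMeasurable U P) (hZ : ∀ i, AEMeasurable (Z i) P)
    (h : iIndepFun (Fin.cons X (Fin.cons U Z) : Fin (n + 2) → Ω → ℝ) P) :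
    P.map (fun ω => ((X ω, U ω), fun i => Z i ω)) =
      ((P.map X).prod (P.map U)).prod (Measure.pi fun i => P.map (Z i)) := by
  have := Measure.isProbabilityMeasure_map hX
  have := Measure.isProbabilityMeasure_map hU
  have := fun i => Measure.isProbabilityMeasure_map (hZ i)
  set V : Fin (n + 2) → Ω → ℝ := Fin.cons X (Fin.cons U Z) with hV
  have hm : ∀ i, AEMeasurable (V i) P := fun i => by
    cases i using Fin.cases with
    | zero => exact hX
    | succ i =>
      cases i using Fin.cases with
      | zero => exact hU
      | succ i => exact hZ i
  have := fun i => Measure.isProbabilityMeasure_map (hm i)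
  rw [iIndepFun_iff_map_fun_eq_pi_map hm] at h
  let e : (Fin (n + 2) → ℝ) → (ℝ × ℝ) × (Fin n → ℝ) := fun v => ((v 0, v 1), fun i => v i.succ.succ)
  have he : Measurable e := by fun_prop
  have hcomp : (fun ω => ((X ω, U ω), fun i => Z i ω)) = e ∘ fun ω i => V i ω := rfl
  rw [hcomp, ← AEMeasurable.map_map_of_aemeasurable he.aemeasurable (aemeasurable_pi_iff.2 hm), h]
  -- Only regrouping is left: peel two coordinates off the product over `Fin (n + 2)`.
  refine Measure.ext_of_lintegral _ fun f hf => ?_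
  rw [lintegral_map hf he, lintegral_prod _ hf.aemeasurable,
    lintegral_prod _ (hf.lintegral_prod_right').aemeasurable]
  refine (lintegral_pi_fin_succ _ (hf.comp he)).trans ?_
  refine lintegral_congr fun x => ?_
  have hcons : Measurable fun y : Fin (n + 1) → ℝ => (Fin.cons x y : Fin (n + 2) → ℝ) := by
    fun_prop
  exact lintegral_pi_fin_succ _ ((hf.comp he).comp hcons)

/-- The joint distribution function of `(X_j, r)` in terms of the multivariate Student law. -/
theorem measure_cons_studentDependencyFunction_mem_Iic {n : ℕ} {ν : ℝ} (hν : 0 < ν)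
    {L R : Matrix (Fin (n + 1)) (Fin (n + 1)) ℝ} (hR : IsCorrelationMatrix R)
    (hL : IsCholeskyFactor L R) (μ₀ : Measure ℝ) [IsProbabilityMeasure μ₀] (μ : Fin n → Measure ℝ)
    (x : Fin (n + 1) → ℝ) :
    ((μ₀.prod (volume.restrict (Set.Ioo 0 1))).prod
        (Measure.pi fun i : Fin n => studentMeasure (ν + ((i : ℝ) + 1))))
      {p | (Fin.cons p.1.1 (studentDependencyFunction ν L μ₀ μ p.1 p.2) : Fin (n + 1) → ℝ) ≤ x} =
    multivariateStudent ν R {y | ∀ k, studentCDF ν (y k) ≤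
      (Fin.cons (cdf μ₀ (x 0)) (fun i => cdf (μ i) (x i.succ)) : Fin (n + 1) → ℝ) k} := by
  set u : Fin (n + 1) → ℝ := Fin.cons (cdf μ₀ (x 0)) fun i => cdf (μ i) (x i.succ) with hu
  have hmeas : MeasurableSet {y : Fin (n + 1) → ℝ | ∀ k, studentCDF ν (y k) ≤ u k} := by
    have hT := (continuous_studentCDF hν).measurable
    have he : {y : Fin (n + 1) → ℝ | ∀ k, studentCDF ν (y k) ≤ u k} =
        ⋂ k, {y | studentCDF ν (y k) ≤ u k} := by
      ext y
      simp
    rw [he]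
    exact MeasurableSet.iInter fun k =>
      measurableSet_le (hT.comp (measurable_pi_apply k)) measurable_const
  rw [hL.eq_mul_transpose, ← map_studentY hν L μ₀,
    Measure.map_apply (measurable_studentY hν L μ₀) hmeas]
  refine measure_congr (Filter.eventuallyEq_set.2 ?_)
  -- Needed to cancel `T_ν` against its inverse in coordinate `0`; the other coordinates use only
  -- that `T_ν` has values in `(0, 1)`.
  have hτ : ∀ᵐ v ∂μ₀.prod ((volume : Measure ℝ).restrict (Set.Ioo 0 1)),
      distributionalTransform μ₀ v.1 v.2 ∈ Set.Ioo (0 : ℝ) 1 := by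
    refine ae_of_ae_map (measurable_distributionalTransform μ₀).aemeasurable ?_
    rw [map_distributionalTransform]
    exact ae_restrict_mem measurableSet_Ioo
  have hx := Filter.eventuallyEq_set.1
    (setOf_fst_le_ae_eq_distributionalTransform_le μ₀ (x 0))
  filter_upwards [Measure.quasiMeasurePreserving_fst.ae hτ,
    Measure.quasiMeasurePreserving_fst.ae hx] with p hp hp'
  have h0 : studentCDF ν (studentY ν L μ₀ p.1 p.2 0) ≤ cdf μ₀ (x 0) ↔ p.1.1 ≤ x 0 := by
    rw [studentY_zero ν hR hL, studentCDF_studentCDFInv hν hp]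
    exact hp'.symm
  have hs : ∀ i : Fin n, studentCDF ν (studentY ν L μ₀ p.1 p.2 i.succ) ≤
      cdf (μ i) (x i.succ) ↔ studentDependencyFunction ν L μ₀ μ p.1 p.2 i ≤ x i.succ := fun i =>
    (generalizedInverse_cdf_le_iff (μ i) (studentCDF_mem_Ioo hν _) _).symm
  simp only [Set.mem_preimage, Set.mem_ofPred_eq, Pi.le_def, Fin.forall_fin_succ,
    hu, Fin.cons_zero, Fin.cons_succ, h0, hs]

theorem isProbabilityMeasure_multivariateStudent {d : ℕ} {ν : ℝ} (hν : 0 < ν)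
    (R : Matrix (Fin d) (Fin d) ℝ) : IsProbabilityMeasure (multivariateStudent ν R) := by
  have := isProbabilityMeasure_gammaMeasure (show 0 < ν / 2 by positivity)
    (show (0 : ℝ) < 1 / 2 by norm_num)
  exact Measure.isProbabilityMeasure_map (Measurable.aemeasurable (by fun_prop))

theorem HasCopula.measure_cons_mem_Iic {Ω : Type*} [MeasurableSpace Ω] {P : Measure Ω}
    [IsProbabilityMeasure P] {n : ℕ} {ν : ℝ} (hν : 0 < ν)
    {R : Matrix (Fin (n + 1)) (Fin (n + 1)) ℝ} {X₀ : Ω → ℝ} {X' : Fin n → Ω → ℝ}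
    (h : HasCopula P (Fin.cons X₀ X' : Fin (n + 1) → Ω → ℝ) (studentCopula ν R))
    (x : Fin (n + 1) → ℝ) :
    P {ω | (Fin.cons (X₀ ω) (fun i => X' i ω) : Fin (n + 1) → ℝ) ≤ x} =
      multivariateStudent ν R {y | ∀ k, studentCDF ν (y k) ≤
        (Fin.cons (cdf (P.map X₀) (x 0)) (fun i => cdf (P.map (X' i)) (x i.succ)) :
          Fin (n + 1) → ℝ) k} := by
  have := isProbabilityMeasure_multivariateStudent hν R
  have hcdf : (fun k => cdf (P.map ((Fin.cons X₀ X' : Fin (n + 1) → Ω → ℝ) k)) (x k)) =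
      Fin.cons (cdf (P.map X₀) (x 0)) (fun i => cdf (P.map (X' i)) (x i.succ)) := by
    funext k
    cases k using Fin.cases <;> rfl
  have hset : {ω | ∀ k, (Fin.cons X₀ X' : Fin (n + 1) → Ω → ℝ) k ω ≤ x k} =
      {ω | (Fin.cons (X₀ ω) (fun i => X' i ω) : Fin (n + 1) → ℝ) ≤ x} := by
    ext ω
    simp only [Set.mem_ofPred_eq, Pi.le_def, Fin.forall_fin_succ, Fin.cons_zero, Fin.cons_succ]
  have hx := h x
  rw [hcdf, hset, studentCopula] at hx
  exact (measureReal_eq_measureReal_iff (measure_ne_top _ _) (measure_ne_top _ _)).1 hx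

theorem lemma2 {Ω : Type*} [MeasurableSpace Ω] (P : Measure Ω) [IsProbabilityMeasure P]
    (n : ℕ) (ν : ℝ) (hν : 0 < ν)
    (R L : Matrix (Fin (n + 1)) (Fin (n + 1)) ℝ)
    (hR : IsCorrelationMatrix R) (hL : IsCholeskyFactor L R)
    (X : Fin (n + 1) → Ω → ℝ) (hX : ∀ k, Measurable (X k))
    (j : Fin (n + 1)) (w : Fin n ≃ {k : Fin (n + 1) // k ≠ j})
    (U : Ω → ℝ) (hU : HasLaw U (volume.restrict (Set.Ioo 0 1)) P)
    (Z : Fin n → Ω → ℝ)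
    (hZ : ∀ i : Fin n, HasLaw (Z i) (studentMeasure (ν + ((i : ℝ) + 1))) P)
    (hindep : iIndepFun (Fin.cons (X j) (Fin.cons U Z) : Fin (n + 2) → Ω → ℝ) P)
    (hcopula : HasCopula P
      (Fin.cons (X j) (fun i => X (w i)) : Fin (n + 1) → Ω → ℝ) (studentCopula ν R)) :
    IsDependencyFunction P (X j) (fun i => X (w i)) U Z
      (studentDependencyFunction ν L (P.map (X j)) (fun i => P.map (X (w i)))) := by
  have hμ₀ : IsProbabilityMeasure (P.map (X j)) :=
    Measure.isProbabilityMeasure_map (hX j).aemeasurable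
  have hrm := measurable_studentDependencyFunction hν L (P.map (X j))
    fun i => P.map (X (w i))
  have hZm : ∀ i, AEMeasurable (Z i) P := fun i => (hZ i).aemeasurable
  have hUm : AEMeasurable U P := hU.aemeasurable
  have hlaw : P.map (fun ω => ((X j ω, U ω), fun i => Z i ω)) =
      ((P.map (X j)).prod (volume.restrict (Set.Ioo 0 1))).prod
        (Measure.pi fun i : Fin n => studentMeasure (ν + ((i : ℝ) + 1))) := by
    have h := map_prod_prod_pi_of_iIndepFun (hX j).aemeasurable hUm hZm hindep
    simpa only [hU.map_eq, fun i => (hZ i).map_eq] using h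
  have hS : AEMeasurable (fun ω => ((X j ω, U ω), fun i => Z i ω)) P :=
    ((hX j).aemeasurable.prodMk hUm).prodMk (aemeasurable_pi_iff.2 hZm)
  have hV : Measurable fun p : (ℝ × ℝ) × (Fin n → ℝ) => (Fin.cons p.1.1
      (studentDependencyFunction ν L (P.map (X j)) (fun i => P.map (X (w i))) p.1 p.2) :
        Fin (n + 1) → ℝ) := by
    have hc : Measurable fun p : ℝ × (Fin n → ℝ) => (Fin.cons p.1 p.2 : Fin (n + 1) → ℝ) := by
      fun_prop
    exact hc.comp (measurable_fst.fst.prodMk hrm)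
  have hX' : Measurable fun ω => (Fin.cons (X j ω) (fun i => X (w i) ω) : Fin (n + 1) → ℝ) := by
    have hc : Measurable fun p : ℝ × (Fin n → ℝ) => (Fin.cons p.1 p.2 : Fin (n + 1) → ℝ) := by
      fun_prop
    exact hc.comp ((hX j).prodMk (measurable_pi_iff.2 fun i => hX (w i)))
  -- The joint law is compared on `Fin (n + 1) → ℝ`, where lower orthants determine it; both
  -- required identities are its images under projections.
  have hid : IdentDistrib (fun ω => (Fin.cons (X j ω) (fun i => X (w i) ω) : Fin (n + 1) → ℝ))
      ((fun p : (ℝ × ℝ) × (Fin n → ℝ) => (Fin.cons p.1.1 (studentDependencyFunction ν L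
        (P.map (X j)) (fun i => P.map (X (w i))) p.1 p.2) : Fin (n + 1) → ℝ)) ∘
          fun ω => ((X j ω, U ω), fun i => Z i ω)) P P := by
    refine ⟨hX'.aemeasurable, hV.comp_aemeasurable hS, ?_⟩
    have := Measure.isProbabilityMeasure_map (μ := P) hX'.aemeasurable
    have := Measure.isProbabilityMeasure_map (μ := P) (hV.comp_aemeasurable hS)
    refine Measure.ext_of_pi_Iic _ _ (by rw [measure_univ, measure_univ]) fun x => ?_
    rw [← AEMeasurable.map_map_of_aemeasurable hV.aemeasurable hS, hlaw,
      Measure.map_apply hX' measurableSet_Iic, Measure.map_apply hV measurableSet_Iic]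
    exact (hcopula.measure_cons_mem_Iic hν x).trans
      (measure_cons_studentDependencyFunction_mem_Iic hν hR hL _ _ x).symm
  have hsplit : Measurable fun v : Fin (n + 1) → ℝ => (v 0, fun i : Fin n => v i.succ) := by
    fun_prop
  have hjoint := hid.comp hsplit
  exact
    { measurable := hrm
      nested := fun i v z z' h => by
        simp only [studentDependencyFunction]
        rw [studentY_congr ν hL.lower_triangular _ v h]
      indep := hindep
      identDistrib := hjoint.comp measurable_snd
      identDistrib_joint := hjoint }
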